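/- A \emph{semiring} is a set $S$ with two associative binary operations $+$ and $\cdot$ such that $+$ is commutative and $\cdot$ distributes over $+$ on both sides (no neutral elements are required, and $\cdot$ need not be commutative). For a semigroup $(S,\circ)$, a set $A\subseteq S$ is \emph{thick} if for every finite $F\subseteq S$ there is $x\in S$ with $F\circ x\subseteq A$; it is \emph{syndetic} if there is a finite $F\subseteq S$ with $S=\bigcup_{s\in F}s^{-1}A$, where $s^{-1}A=\{x\in S: s\circ x\in A\}$; and it is \emph{piecewise syndetic} if there is a finite $F\subseteq S$ such that $\bigcup_{s\in F}s^{-1}A$ is thick. Let $(S,+,\cdot)$ be a semiring such that $Ss=\{as:a\in S\}$ is piecewise syndetic in $(S,+)$ for every $s\in S$. Let $T\subseteq S$ be thick in $(S,\cdot)$, let $M_0,M_1\subseteq S$ be syndetic in $(S,\cdot)$, and let $S=C_0\cup C_1$ be a partition of $S$ into two disjoint sets such that $T\cap M_0\subseteq C_0$ and $T\cap M_1\subseteq C_1$. Then for every $k\in\mathbb{N}$ there are $y\in S$ and $i\in\{0,1\}$ such that the set $$\{x\in S:\{x,y,xy\}\cup\{x+jy:1\le j\le k\}\subseteq C_i\}$$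 is piecewise syndetic in $(S,+)$. -/

import Mathlib

/-- `A` is thick in the semigroup `(S, ·)`: every finite subset of `S` has a right translate
`F · x` inside `A`.  The additive version is `AddThick`. -/
@[to_additive /-- `A` is thick in `(S, +)`: every finite subset `F` of `S` has a translate
`F + x` inside `A`. -/]
def MulThick {S : Type*} [Mul S] (A : Set S) : Prop :=
  ∀ F : Finset S, ∃ x : S, ∀ s ∈ F, s * x ∈ A

/-- `A` is syndetic in the semigroup `(S, ·)`: finitely many of the sets
`s⁻¹A = {x | s * x ∈ A}` cover `S`.  The additive version is `AddSyndetic`. -/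
@[to_additive /-- `A` is syndetic in `(S, +)`: finitely many of the sets
`-s + A = {x | s + x ∈ A}` cover `S`. -/]
def MulSyndetic {S : Type*} [Mul S] (A : Set S) : Prop :=
  ∃ F : Finset S, ⋃ s ∈ F, {x : S | s * x ∈ A} = Set.univ

/-- `A` is piecewise syndetic in the semigroup `(S, ·)`: some finite union of sets
`s⁻¹A = {x | s * x ∈ A}` is thick.  The additive version is `AddPiecewiseSyndetic`. -/
@[to_additive /-- `A` is piecewise syndetic in `(S, +)`: some finite union of sets
`-s + A = {x | s + x ∈ A}` is thick in `(S, +)`. -/]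
def MulPiecewiseSyndetic {S : Type*} [Mul S] (A : Set S) : Prop :=
  ∃ F : Finset S, MulThick (⋃ s ∈ F, {x : S | s * x ∈ A})

/-- `succMultiple n y` is the positive multiple `(n + 1) y = y + y + ⋯ + y` (`n + 1` summands).
No zero element is needed. -/
def succMultiple {S : Type*} [Add S] : ℕ → S → S
  | 0, y => y
  | n + 1, y => succMultiple n y + y

/-- The set `{x, y, xy, x + y, x + 2y, …, x + ky}`. -/
def sumProductPattern {S : Type*} [Add S] [Mul S] (k : ℕ) (x y : S) : Set S :=
  {x, y, x * y} ∪ {z : S | ∃ j : ℕ, j < k ∧ z = x + succMultiple j y}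

section PiecewiseSyndetic

open scoped Pointwise

variable {S : Type*} [AddCommSemigroup S]

theorem addPiecewiseSyndetic_iff {A : Set S} :
    AddPiecewiseSyndetic A ↔
      ∃ F : Finset S, ∀ G : Finset S, ∃ x : S, ∀ g ∈ G, ∃ f ∈ F, f + (g + x) ∈ A := by
  simp only [AddPiecewiseSyndetic, AddThick, Set.mem_iUnion, Set.mem_ofPred_eq, exists_prop]

theorem AddPiecewiseSyndetic.mono {A B : Set S} (hA : AddPiecewiseSyndetic A) (h : A ⊆ B) :
    AddPiecewiseSyndetic B := by
  rw [addPiecewiseSyndetic_iff] at hA ⊢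
  obtain ⟨F, hF⟩ := hA
  refine ⟨F, fun G => ?_⟩
  obtain ⟨x, hx⟩ := hF G
  exact ⟨x, fun g hg => (hx g hg).imp fun f hf => ⟨hf.1, h hf.2⟩⟩

theorem AddPiecewiseSyndetic.nonempty [Nonempty S] {A : Set S} (hA : AddPiecewiseSyndetic A) :
    A.Nonempty := by
  obtain ⟨F, hF⟩ := addPiecewiseSyndetic_iff.1 hA
  obtain ⟨x, hx⟩ := hF {Classical.arbitrary S}
  obtain ⟨f, -, hf⟩ := hx _ (Finset.mem_singleton_self _)
  exact ⟨_, hf⟩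

theorem addPiecewiseSyndetic_univ [Nonempty S] : AddPiecewiseSyndetic (Set.univ : Set S) :=
  addPiecewiseSyndetic_iff.2 ⟨{Classical.arbitrary S}, fun _ =>
    ⟨Classical.arbitrary S, fun _ _ => ⟨_, Finset.mem_singleton_self _, trivial⟩⟩⟩

/-- Piecewise syndetic sets are stable under translation. -/
theorem AddPiecewiseSyndetic.of_translate {A B : Set S} (hA : AddPiecewiseSyndetic A) (c : S)
    (h : ∀ a ∈ A, a + c ∈ B) : AddPiecewiseSyndetic B := by
  rw [addPiecewiseSyndetic_iff] at hA ⊢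
  obtain ⟨F, hF⟩ := hA
  refine ⟨F, fun G => ?_⟩
  obtain ⟨x, hx⟩ := hF G
  refine ⟨x + c, fun g hg => ?_⟩
  obtain ⟨f, hf, hfA⟩ := hx g hg
  exact ⟨f, hf, by simpa only [add_assoc] using h _ hfA⟩

/-- Piecewise syndeticity is partition regular. -/
theorem AddPiecewiseSyndetic.of_union {A B : Set S} (h : AddPiecewiseSyndetic (A ∪ B)) :
    AddPiecewiseSyndetic A ∨ AddPiecewiseSyndetic B := by
  classical
  simp only [addPiecewiseSyndetic_iff] at h ⊢
  obtain ⟨F, hF⟩ := h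
  by_contra! hcon
  obtain ⟨G, hG⟩ := hcon.2 F
  obtain ⟨H, hH⟩ := hcon.1 (F + G)
  obtain ⟨x, hx⟩ := hF (G + H)
  obtain ⟨h, hh, hhA⟩ := hH x
  obtain ⟨g, hg, hgB⟩ := hG (h + x)
  obtain ⟨f, hf, hfAB⟩ := hx (g + h) (Finset.add_mem_add hg hh)
  rcases hfAB with hfA | hfB
  · exact hhA (f + g) (Finset.add_mem_add hf hg) (by simpa only [add_assoc] using hfA)
  · exact hgB f hf (by simpa only [add_assoc] using hfB)

theorem AddPiecewiseSyndetic.of_biUnion [Nonempty S] {ι : Type*} {B : ι → Set S} {s : Finset ι}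
    (h : AddPiecewiseSyndetic (⋃ i ∈ s, B i)) : ∃ i ∈ s, AddPiecewiseSyndetic (B i) := by
  classical
  induction s using Finset.induction_on with
  | empty => simpa using h.nonempty
  | insert a s _ ih =>
    rw [Finset.set_biUnion_insert] at h
    rcases h.of_union with h | h
    · exact ⟨a, Finset.mem_insert_self _ _, h⟩
    · obtain ⟨i, hi, hB⟩ := ih h
      exact ⟨i, Finset.mem_insert_of_mem hi, hB⟩

/-- If `S * s` is piecewise syndetic then right multiplication by `s` preserves piecewise
syndetic sets. -/
theorem AddPiecewiseSyndetic.image_mul_right [Mul S] [RightDistribClass S] {A : Set S}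
    (hA : AddPiecewiseSyndetic A) {s : S}
    (hs : AddPiecewiseSyndetic (Set.range fun a : S => a * s)) :
    AddPiecewiseSyndetic ((fun a => a * s) '' A) := by
  classical
  rw [addPiecewiseSyndetic_iff] at hA hs ⊢
  obtain ⟨F, hF⟩ := hA
  obtain ⟨E, hE⟩ := hs
  refine ⟨F.image (fun a => a * s) + E, fun G => ?_⟩
  obtain ⟨x, hx⟩ := hE G
  choose! e he b hb using hx
  obtain ⟨x', hx'⟩ := hF (G.image b)
  refine ⟨x + x' * s, fun g hg => ?_⟩
  obtain ⟨f, hf, hfA⟩ := hx' (b g) (Finset.mem_image_of_mem _ hg)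
  refine ⟨f * s + e g, Finset.add_mem_add (Finset.mem_image_of_mem _ hf) (he g hg), _, hfA, ?_⟩
  have := hb g hg
  dsimp only at this ⊢
  rw [add_mul, add_mul, this]
  simp only [add_assoc]

end PiecewiseSyndetic

section WithZero

variable {S : Type*}

/-- The sum of an element of `S` and an element of `WithZero S`, as an element of `S`. -/
def addWithZero [Add S] (a : S) (z : WithZero S) : S :=
  WithZero.recZeroCoe (motive := fun _ => S) a (fun b => a + b) z

@[simp]
theorem coe_addWithZero [AddCommSemigroup S] (a : S) (z : WithZero S) :
    ((addWithZero a z : S) : WithZero S) = a + z := by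
  cases z with
  | zero => simp [addWithZero]
  | coe b => simp [addWithZero]

theorem coe_succMultiple [AddCommSemigroup S] (n : ℕ) (y : S) :
    ((succMultiple n y : S) : WithZero S) = (n + 1) • (y : WithZero S) := by
  induction n with
  | zero => simp [succMultiple]
  | succ n ih => rw [succMultiple, WithZero.coe_add, ih, succ_nsmul _ (n + 1)]

/-- A semiring without neutral elements becomes a `NonUnitalSemiring` once a zero is adjoined. -/
instance WithZero.instNonUnitalSemiringOfDistribClass [AddCommSemigroup S] [Semigroup S]
    [LeftDistribClass S] [RightDistribClass S] : NonUnitalSemiring (WithZero S) where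
  left_distrib := left_distrib
  right_distrib := right_distrib
  zero_mul := zero_mul
  mul_zero := mul_zero
  mul_assoc := mul_assoc

theorem exists_coe_eq_sum [AddCommSemigroup S] {ι : Type*} {α : Finset ι} (hα : α.Nonempty)
    (x : ι → S) : ∃ a : S, (a : WithZero S) = ∑ i ∈ α, (x i : WithZero S) := by
  classical
  obtain ⟨i, hi⟩ := hα
  refine ⟨addWithZero (x i) (∑ j ∈ α.erase i, (x j : WithZero S)), ?_⟩
  rw [coe_addWithZero, Finset.add_sum_erase α (fun j => (x j : WithZero S)) hi]

end WithZero

section VanDerWaerden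

variable {S : Type*} [AddCommSemigroup S]

/-- A van der Waerden theorem inside piecewise syndetic sets, with a uniform bound on the number of
summands. -/
theorem AddPiecewiseSyndetic.exists_sum_shift [Nonempty S] {A : Set S}
    (hA : AddPiecewiseSyndetic A) (J : Type*) [Finite J] :
    ∃ (ι : Type) (_ : Fintype ι), ∀ φ : J → ι → WithZero S, ∃ α : Finset ι, α.Nonempty ∧
      AddPiecewiseSyndetic {a : S | ∀ j, addWithZero a (∑ i ∈ α, φ j i) ∈ A} := by
  classical
  have := Fintype.ofFinite J
  obtain ⟨F, hF⟩ := addPiecewiseSyndetic_iff.1 hA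
  obtain ⟨ι, hι, hJ⟩ := Combinatorics.Line.exists_mono_in_high_dimension J F
  refine ⟨ι, hι, fun φ => ?_⟩
  suffices h : AddPiecewiseSyndetic (⋃ α ∈ Finset.univ.filter (fun α : Finset ι => α.Nonempty),
      {a : S | ∀ j, addWithZero a (∑ i ∈ α, φ j i) ∈ A}) by
    obtain ⟨α, hα, h⟩ := h.of_biUnion
    exact ⟨α, (Finset.mem_filter.1 hα).2, h⟩
  let fixed : (ι → Option J) → WithZero S := fun u => ∑ i, (u i).elim 0 fun j => φ j i
  refine addPiecewiseSyndetic_iff.2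
    ⟨(F ×ˢ Finset.univ).image fun q => addWithZero q.1 (fixed q.2), fun G => ?_⟩
  obtain ⟨x, hx⟩ := hF ((G ×ˢ (Finset.univ : Finset (ι → J))).image
    fun q => addWithZero q.1 (∑ i, φ (q.2 i) i))
  refine ⟨x, fun g hg => ?_⟩
  have hx' : ∀ v : ι → J, ∃ f : F, (f : S) + (addWithZero g (∑ i, φ (v i) i) + x) ∈ A := by
    intro v
    obtain ⟨f, hf, h⟩ := hx _ (Finset.mem_image_of_mem _
      (Finset.mk_mem_product hg (Finset.mem_univ v)))
    exact ⟨⟨f, hf⟩, h⟩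
  choose c hc using hx'
  obtain ⟨l, f, hl⟩ := hJ c
  refine ⟨addWithZero f (fixed l.idxFun), Finset.mem_image.2
    ⟨(f, l.idxFun), Finset.mk_mem_product f.2 (Finset.mem_univ _), rfl⟩, ?_⟩
  simp only [Set.mem_iUnion]
  refine ⟨Finset.univ.filter fun i => l.idxFun i = none, ?_, fun j => ?_⟩
  · obtain ⟨i, hi⟩ := l.proper
    exact Finset.mem_filter.2 ⟨Finset.mem_univ _, i, by simpa using hi⟩
  · have hsum : ∑ i, φ (l j i) i =
        fixed l.idxFun + ∑ i ∈ Finset.univ.filter (fun i => l.idxFun i = none), φ j i := by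
      rw [Finset.sum_filter, ← Finset.sum_add_distrib]
      refine Finset.sum_congr rfl fun i _ => ?_
      cases h : l.idxFun i <;> simp [h]
    have := hc (l j)
    rw [hl j, hsum] at this
    convert this using 1
    apply WithZero.coe_injective
    simp only [coe_addWithZero, WithZero.coe_add]
    abel

end VanDerWaerden

section FiniteIPStar

variable {S : Type*} [AddCommSemigroup S]

/-- `E` meets the set of finite sums of every family of elements of `S` indexed by a fixed finite
type, i.e. `E` is an `IPᵣ*` set for some `r`. -/
def FiniteIPStar (E : Set S) : Prop :=
  ∃ (ι : Type) (_ : Fintype ι), ∀ x : ι → S, ∃ α : Finset ι, ∃ a ∈ E,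
    (a : WithZero S) = ∑ i ∈ α, (x i : WithZero S)

/-- The common differences of progressions in a piecewise syndetic set form a `FiniteIPStar`
set. -/
theorem AddPiecewiseSyndetic.finiteIPStar_progression [Nonempty S] {A : Set S}
    (hA : AddPiecewiseSyndetic A) (k : ℕ) :
    FiniteIPStar {y : S | AddPiecewiseSyndetic
      {a : S | a ∈ A ∧ ∀ j < k, a + succMultiple j y ∈ A}} := by
  obtain ⟨ι, hι, h⟩ := hA.exists_sum_shift (Fin (k + 1))
  refine ⟨ι, hι, fun x => ?_⟩
  obtain ⟨α, hα, hps⟩ := h fun j i => (j : ℕ) • (x i : WithZero S)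
  obtain ⟨y, hy⟩ := exists_coe_eq_sum hα x
  refine ⟨α, y, hps.mono fun a ha => ?_, hy⟩
  have key : ∀ j ≤ k, addWithZero a (j • (y : WithZero S)) ∈ A := by
    intro j hj
    have := ha ⟨j, Nat.lt_succ_of_le hj⟩
    rwa [← Finset.smul_sum, ← hy] at this
  refine ⟨?_, fun j hj => ?_⟩
  · convert key 0 k.zero_le using 1
    apply WithZero.coe_injective
    simp
  · convert key (j + 1) hj using 1
    apply WithZero.coe_injective
    rw [WithZero.coe_add, coe_succMultiple, coe_addWithZero]

/-- The differences of elements of `S * w` form a `FiniteIPStar` set. -/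
theorem finiteIPStar_sub_range_mul [Mul S] [Nonempty S] {w : S}
    (hw : AddPiecewiseSyndetic (Set.range fun a : S => a * w)) :
    FiniteIPStar {b : S | ∃ u v : S, b + u * w = v * w} := by
  obtain ⟨ι, hι, h⟩ := hw.finiteIPStar_progression 1
  refine ⟨ι, hι, fun x => ?_⟩
  obtain ⟨α, b, hb, hsum⟩ := h x
  refine ⟨α, b, ?_, hsum⟩
  obtain ⟨_, ⟨u, rfl⟩, hv⟩ := AddPiecewiseSyndetic.nonempty hb
  obtain ⟨v, hv⟩ := hv 0 one_pos
  refine ⟨u, v, ?_⟩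
  dsimp only [succMultiple] at hv
  rw [hv, add_comm]

variable [Semigroup S] [LeftDistribClass S] [RightDistribClass S]

/-- Simultaneous progressions: in a piecewise syndetic set `A`, many `a` satisfy
`a * w + j b ∈ A * w` and `a + j (w * b) ∈ A` for all `j ≤ k`, for a `FiniteIPStar` set of `b`. -/
theorem AddPiecewiseSyndetic.finiteIPStar_progression_mul [Nonempty S] {A : Set S}
    (hA : AddPiecewiseSyndetic A) {w : S}
    (hw : AddPiecewiseSyndetic (Set.range fun a : S => a * w)) (k : ℕ) :
    FiniteIPStar {b : S | AddPiecewiseSyndetic {a : S | ∀ j ≤ k,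
      (∃ c ∈ A, (c : WithZero S) * w = a * w + j • (b : WithZero S)) ∧
      ∃ c ∈ A, (c : WithZero S) = a + j • (w * b : WithZero S)}} := by
  classical
  obtain ⟨κ, hκ, hR⟩ := finiteIPStar_sub_range_mul hw
  obtain ⟨ι, hι, h⟩ := hA.exists_sum_shift (Fin (k + 2) × Fin (k + 2))
  refine ⟨ι × κ, inferInstance, fun x => ?_⟩
  choose β b hb hbsum using fun i => hR fun m => x (i, m)
  choose u v huv using hb
  let Z := WithZero S
  obtain ⟨α, hα, hps⟩ := h fun j i =>
    (k + 1 - (j.1 : ℕ)) • (u i : Z) + (j.1 : ℕ) • (v i : Z) +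
      ((k + 1 - (j.2 : ℕ)) • (w * u i * w : Z) + (j.2 : ℕ) • (w * v i * w : Z))
  obtain ⟨U, hU⟩ := exists_coe_eq_sum hα u
  obtain ⟨V, hV⟩ := exists_coe_eq_sum hα v
  obtain ⟨B, hB⟩ := exists_coe_eq_sum hα b
  have hBUV : (B + U * w : Z) = V * w := by
    rw [hB, hU, hV, Finset.sum_mul, Finset.sum_mul, ← Finset.sum_add_distrib]
    refine Finset.sum_congr rfl fun i _ => ?_
    exact_mod_cast congrArg (fun s : S => (s : Z)) (huv i)
  have hsum : ∀ p q : ℕ, ∀ r s : ℕ,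
      ∑ i ∈ α, (p • (u i : Z) + q • (v i : Z) + (r • (w * u i * w : Z) + s • (w * v i * w : Z))) =
        p • (U : Z) + q • (V : Z) + (r • (w * U * w : Z) + s • (w * V * w : Z)) := by
    intro p q r s
    simp only [Finset.sum_add_distrib, ← Finset.smul_sum, ← Finset.sum_mul, ← Finset.mul_sum,
      ← hU, ← hV]
  refine ⟨α.sigma β |>.map (Equiv.sigmaEquivProd ι κ).toEmbedding, B, ?_, ?_⟩
  · refine hps.of_translate (succMultiple k U + succMultiple k (w * U * w)) fun a ha j hj => ?_
    have key : ∀ j ≤ k + 1, ∀ j' ≤ k + 1, ∃ c ∈ A, (c : Z) = a + ((k + 1 - j) • (U : Z) +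
        j • (V : Z) + ((k + 1 - j') • (w * U * w : Z) + j' • (w * V * w : Z))) := by
      intro j hj j' hj'
      refine ⟨_, ha (⟨j, by omega⟩, ⟨j', by omega⟩), ?_⟩
      rw [coe_addWithZero, hsum]
    have hsplit : ∀ z : Z, (k + 1) • z = (k + 1 - j) • z + j • z := by
      intro z
      rw [← add_nsmul]
      congr 1
      omega
    simp only [WithZero.coe_add, coe_succMultiple, WithZero.coe_mul]
    constructor
    · obtain ⟨c, hc, hceq⟩ := key j (by omega) 0 (by omega)
      refine ⟨c, hc, ?_⟩
      rw [hceq, hsplit (U : Z)]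
      simp only [add_mul, smul_mul_assoc, ← hBUV, nsmul_add, zero_nsmul, add_zero, Nat.sub_zero]
      abel
    · obtain ⟨c, hc, hceq⟩ := key 0 (by omega) j (by omega)
      refine ⟨c, hc, ?_⟩
      rw [hceq, hsplit (w * U * w : Z), mul_assoc _ (V : Z), ← hBUV]
      simp only [mul_add, nsmul_add, zero_nsmul, add_zero, Nat.sub_zero, mul_assoc]
      abel
  · rw [hB, Finset.sum_map, Finset.sum_sigma]
    exact Finset.sum_congr rfl fun i _ => hbsum i

end FiniteIPStar

section Ultrafilter

open Filter

theorem MulSyndetic.exists_eventually_mul_mem {S : Type*} [Mul S] {M : Set S} (hM : MulSyndetic M)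
    (p : Ultrafilter S) : ∃ s : S, ∀ᶠ x in p, s * x ∈ M := by
  obtain ⟨F, hF⟩ := hM
  by_contra! hcon
  have := (eventually_all_finset (l := (p : Filter S)) F).2
    fun s _ => hcon s
  obtain ⟨x, hx⟩ := this.exists
  have hmem : x ∈ ⋃ s ∈ F, {x : S | s * x ∈ M} := hF ▸ Set.mem_univ x
  simp only [Set.mem_iUnion] at hmem
  obtain ⟨s, hs, hxs⟩ := hmem
  exact hx s hs hxs

attribute [local instance] Ultrafilter.mul Ultrafilter.add Ultrafilter.semigroup
  Ultrafilter.addSemigroup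

variable {S : Type*} [AddCommSemigroup S]

theorem Hindman.exists_coe_of_mem_FS_map_coe {b : Stream' (WithZero S)} {m : WithZero S}
    (h : m ∈ Hindman.FS b) :
    ∀ a : Stream' S, b = Stream'.map (fun s : S => (s : WithZero S)) a →
      ∃ s ∈ Hindman.FS a, (s : WithZero S) = m := by
  induction h with
  | head' b => exact fun a ha => ⟨a.head, .head' a, by subst ha; rfl⟩
  | tail' b m h ih =>
    intro a ha
    obtain ⟨s, hs, rfl⟩ := ih a.tail (by subst ha; rfl)
    exact ⟨s, .tail' a s hs, rfl⟩
  | cons' b m h ih =>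
    intro a ha
    obtain ⟨s, hs, rfl⟩ := ih a.tail (by subst ha; rfl)
    exact ⟨a.head + s, .cons' a s hs, by subst ha; rfl⟩

theorem FiniteIPStar.mem_of_add_self_eq {E : Set S} (hE : FiniteIPStar E) {p : Ultrafilter S}
    (hp : p + p = p) : E ∈ p := by
  classical
  by_contra hE'
  obtain ⟨a, ha⟩ := Hindman.exists_FS_of_large p hp Eᶜ (Ultrafilter.compl_mem_iff_notMem.2 hE')
  obtain ⟨ι, hι, h⟩ := hE
  let e : ι ↪ ℕ := (Fintype.equivFin ι).toEmbedding.trans Fin.valEmbedding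
  obtain ⟨α, s, hs, hsum⟩ := h fun i => a.get (e i)
  have hα : (α.map e).Nonempty := by
    rw [Finset.map_nonempty, Finset.nonempty_iff_ne_empty]
    rintro rfl
    simp at hsum
  obtain ⟨t, ht, hts⟩ := Hindman.exists_coe_of_mem_FS_map_coe
    (Hindman.FS.finsetSum (Stream'.map (fun s : S => (s : WithZero S)) a) (α.map e) hα) a rfl
  rw [Finset.sum_map] at hts
  have : t = s := WithZero.coe_injective (hts.trans hsum.symm)
  exact ha (this ▸ ht) hs

variable [Semigroup S] [LeftDistribClass S] [RightDistribClass S]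

theorem FiniteIPStar.preimage_mul_left {E : Set S} (hE : FiniteIPStar E) (s : S) :
    FiniteIPStar {x : S | s * x ∈ E} := by
  obtain ⟨ι, hι, h⟩ := hE
  refine ⟨ι, hι, fun x => ?_⟩
  obtain ⟨α, a, ha, hsum⟩ := h fun i => s * x i
  have hα : α.Nonempty := by
    rw [Finset.nonempty_iff_ne_empty]
    rintro rfl
    simp at hsum
  obtain ⟨b, hb⟩ := exists_coe_eq_sum hα x
  refine ⟨α, b, ?_, hb⟩
  have : s * b = a := by
    apply WithZero.coe_injective
    rw [hsum, WithZero.coe_mul, hb, Finset.mul_sum]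
    simp only [WithZero.coe_mul]
  rwa [Set.mem_ofPred_eq, this]

theorem FiniteIPStar.eventually_mul_mem {E : Set S} (hE : FiniteIPStar E) (q : Ultrafilter S) :
    FiniteIPStar {s : S | ∀ᶠ x in q, s * x ∈ E} := by
  classical
  obtain ⟨ι, hι, h⟩ := hE
  refine ⟨ι, hι, fun x => ?_⟩
  have hcov : ∀ᶠ z : S in (q : Filter S), ∃ α ∈ (Set.univ : Set (Finset ι)), ∃ a ∈ E,
      (a : WithZero S) = ∑ i ∈ α, ((x i : WithZero S) * (z : WithZero S)) := by
    refine Eventually.of_forall fun z => ?_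
    obtain ⟨α, a, ha, hsum⟩ := h fun i => x i * z
    exact ⟨α, trivial, a, ha, by simpa only [WithZero.coe_mul] using hsum⟩
  have : ∃ α : Finset ι, ∀ᶠ z : S in (q : Filter S), ∃ a ∈ E,
      (a : WithZero S) = ∑ i ∈ α, ((x i : WithZero S) * (z : WithZero S)) := by
    by_contra! hcon
    have := (eventually_all (l := (q : Filter S))).2
      fun α => hcon α
    obtain ⟨z, ⟨α, -, hα⟩, hz⟩ := (hcov.and this).exists
    obtain ⟨a, ha, hsum⟩ := hα
    exact hz α a ha hsum
  obtain ⟨α, hα⟩ := this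
  have hne : α.Nonempty := by
    obtain ⟨z, a, -, hz⟩ := hα.exists
    rw [Finset.nonempty_iff_ne_empty]
    rintro rfl
    simp at hz
  obtain ⟨b, hb⟩ := exists_coe_eq_sum hne x
  refine ⟨α, b, hα.mono fun z hz => ?_, hb⟩
  obtain ⟨a, ha, hsum⟩ := hz
  have : b * z = a := by
    apply WithZero.coe_injective
    rw [hsum, WithZero.coe_mul, hb, Finset.sum_mul]
  rwa [this]

/-- A multiplicatively thick set `T` carries a multiplicative idempotent ultrafilter `p` such that
all `s⁻¹T` and all `FiniteIPStar` sets belong to `p`. -/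
theorem MulThick.exists_idempotent {T : Set S} (hT : MulThick T) :
    ∃ p : Ultrafilter S, p * p = p ∧ (∀ s : S, ∀ᶠ x in p, s * x ∈ T) ∧
      ∀ E : Set S, FiniteIPStar E → E ∈ p := by
  classical
  obtain ⟨x₀, -⟩ := hT ∅
  have : Nonempty S := ⟨x₀⟩
  let W : Set (Ultrafilter S) := {p | (∀ s : S, {x | s * x ∈ T} ∈ p) ∧
    ∀ E : Set S, FiniteIPStar E → E ∈ p}
  have hmul : ∀ p q : Ultrafilter S, (∀ s : S, {x | s * x ∈ T} ∈ q) →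
      (∀ s : S, {x | s * x ∈ T} ∈ p * q) := by
    intro p q hq s
    refine (Ultrafilter.eventually_mul p q fun x => s * x ∈ T).2 (Eventually.of_forall fun t => ?_)
    have := hq (s * t)
    simp only [mul_assoc] at this
    exact this
  have hne : W.Nonempty := by
    obtain ⟨e, he⟩ := exists_idempotent_of_compact_t2_of_continuous_add_left
      (M := Ultrafilter S) Ultrafilter.continuous_add_left
    choose x hx using hT
    obtain ⟨l, hl⟩ := Ultrafilter.exists_le (map x atTop)
    refine ⟨e * l, hmul e l fun s => hl (((eventually_ge_atTop {s}).mono fun F hF =>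
      hx F s (hF (Finset.mem_singleton_self s)) : ∀ᶠ F in atTop, s * x F ∈ T)),
      fun E hE => ?_⟩
    exact (Ultrafilter.eventually_mul e l fun x => x ∈ E).2
      ((hE.eventually_mul_mem l).mem_of_add_self_eq he)
  have hclosed : IsClosed W := by
    have : W = (⋂ s : S, {p : Ultrafilter S | {x | s * x ∈ T} ∈ p}) ∩
        ⋂ (E : Set S) (_ : FiniteIPStar E), {p : Ultrafilter S | E ∈ p} := by
      ext p
      simp [W]
    rw [this]
    exact (isClosed_iInter fun s => ultrafilter_isClosed_basic _).inter
      (isClosed_iInter fun E => isClosed_iInter fun _ => ultrafilter_isClosed_basic _)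
  obtain ⟨p, ⟨hp₁, hp₂⟩, hpp⟩ := exists_idempotent_in_compact_subsemigroup
    Ultrafilter.continuous_mul_left W hne hclosed.isCompact fun p hp q hq =>
      ⟨hmul p q hq.1, fun E hE => (Ultrafilter.eventually_mul p q fun x => x ∈ E).2
        (Eventually.of_forall fun s => hq.2 _ (hE.preimage_mul_left s))⟩
  exact ⟨p, hpp, hp₁, hp₂⟩

end Ultrafilter

section Pattern

variable {S : Type*} [AddCommSemigroup S] [Semigroup S]

theorem sumProductPattern_subset_iff {k : ℕ} {x y : S} {C : Set S} :
    sumProductPattern k x y ⊆ C ↔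
      x ∈ C ∧ y ∈ C ∧ x * y ∈ C ∧ ∀ j < k, x + succMultiple j y ∈ C := by
  constructor
  · exact fun h => ⟨h (.inl (.inl rfl)), h (.inl (.inr (.inl rfl))), h (.inl (.inr (.inr rfl))),
      fun j hj => h (.inr ⟨j, hj, rfl⟩)⟩
  · rintro ⟨h₁, h₂, h₃, h₄⟩ z ((rfl | rfl | rfl) | ⟨j, hj, rfl⟩)
    exacts [h₁, h₂, h₃, h₄ j hj]

variable [RightDistribClass S]

/-- If the complement of `C` is not piecewise syndetic, every `y ∈ C` has patterns in `C`. -/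
theorem addPiecewiseSyndetic_pattern_of_not [Nonempty S]
    (hS : ∀ s : S, AddPiecewiseSyndetic (Set.range fun a : S => a * s)) {C D : Set S}
    (hcover : ∀ x, x ∈ C ∨ x ∈ D) (hD : ¬ AddPiecewiseSyndetic D) {y : S} (hy : y ∈ C) (k : ℕ) :
    AddPiecewiseSyndetic {x : S | sumProductPattern k x y ⊆ C} := by
  have h : AddPiecewiseSyndetic ({x : S | sumProductPattern k x y ⊆ C} ∪ (D ∪
      ({x : S | x * y ∈ D} ∪ ⋃ j ∈ Finset.range k, {x : S | x + succMultiple j y ∈ D}))) := by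
    refine addPiecewiseSyndetic_univ.mono fun x _ => ?_
    by_contra hx
    simp only [Set.mem_union, Set.mem_ofPred_eq, Set.mem_iUnion, Finset.mem_range, not_or,
      not_exists, sumProductPattern_subset_iff] at hx
    exact hx.1 ⟨(hcover _).resolve_right hx.2.1, hy, (hcover _).resolve_right hx.2.2.1,
      fun j hj => (hcover _).resolve_right (hx.2.2.2 j hj)⟩
  rcases h.of_union with h | h
  · exact h
  refine absurd ?_ hD
  rcases h.of_union with h | h
  · exact h
  rcases h.of_union with h | h
  · exact (h.image_mul_right (hS y)).mono (by rintro _ ⟨x, hx, rfl⟩; exact hx)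
  · obtain ⟨j, -, h⟩ := h.of_biUnion
    exact h.of_translate _ fun _ hx => hx

variable [LeftDistribClass S]

/-- The pattern is found once a product `w * b` lies in the colour of `w` while `b` lies in the
other one, with `w` and `b` suitable for progressions. -/
theorem exists_pattern_of_mul_mem
    (hS : ∀ s : S, AddPiecewiseSyndetic (Set.range fun a : S => a * s)) {C D : Set S}
    (hcover : ∀ x, x ∈ C ∨ x ∈ D) (k : ℕ) {w : S} (hw : w ∈ C)
    (hprog : AddPiecewiseSyndetic {a : S | a ∈ C ∧ ∀ j < k, a + succMultiple j w ∈ C}) :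
    AddPiecewiseSyndetic {x : S | sumProductPattern k x w ⊆ C} ∨
      ∃ E : Set S, FiniteIPStar E ∧ ∀ b ∈ E, b ∈ D → w * b ∈ C →
        AddPiecewiseSyndetic {x : S | sumProductPattern k x (w * b) ⊆ C} ∨
          AddPiecewiseSyndetic {x : S | sumProductPattern k x b ⊆ D} := by
  have : Nonempty S := ⟨w⟩
  rw [or_iff_not_imp_left]
  intro hneg
  have hA : AddPiecewiseSyndetic {a : S | a ∈ C ∧ a * w ∈ D} := by
    refine ((hprog.mono (B := {x : S | sumProductPattern k x w ⊆ C} ∪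
      {a : S | a ∈ C ∧ a * w ∈ D}) fun a ha => ?_).of_union).resolve_left hneg
    rcases hcover (a * w) with h | h
    · exact .inl (sumProductPattern_subset_iff.2 ⟨ha.1, hw, h, ha.2⟩)
    · exact .inr ⟨ha.1, h⟩
  refine ⟨_, hA.finiteIPStar_progression_mul (hS w) k, fun b hb hbD hwb => ?_⟩
  have hprog' := fun (a : S) (ha : ∀ j ≤ k,
      (∃ c ∈ {a : S | a ∈ C ∧ a * w ∈ D}, (c : WithZero S) * w = a * w + j • (b : WithZero S)) ∧
      ∃ c ∈ {a : S | a ∈ C ∧ a * w ∈ D}, (c : WithZero S) = a + j • (w * b : WithZero S)) =>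
    show (a ∈ C ∧ ∀ j < k, a + succMultiple j (w * b) ∈ C) ∧
      (a * w ∈ D ∧ ∀ j < k, a * w + succMultiple j b ∈ D) from by
    have hA0 : a ∈ {a : S | a ∈ C ∧ a * w ∈ D} := by
      obtain ⟨c, hc, hceq⟩ := (ha 0 k.zero_le).2
      rw [zero_nsmul, add_zero] at hceq
      exact WithZero.coe_injective hceq ▸ hc
    refine ⟨⟨hA0.1, fun j hj => ?_⟩, hA0.2, fun j hj => ?_⟩
    · obtain ⟨c, hc, hceq⟩ := (ha (j + 1) hj).2
      have : a + succMultiple j (w * b) = c := by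
        apply WithZero.coe_injective
        rw [hceq, WithZero.coe_add, coe_succMultiple, WithZero.coe_mul]
      exact this ▸ hc.1
    · obtain ⟨c, hc, hceq⟩ := (ha (j + 1) hj).1
      have : a * w + succMultiple j b = c * w := by
        apply WithZero.coe_injective
        rw [WithZero.coe_mul, hceq, WithZero.coe_add, coe_succMultiple, WithZero.coe_mul]
      exact this ▸ hc.2
  have hunion : AddPiecewiseSyndetic ({x : S | sumProductPattern k x (w * b) ⊆ C} ∪
      {x : S | sumProductPattern k (x * w) b ⊆ D}) := by
    refine AddPiecewiseSyndetic.mono hb fun a ha => ?_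
    obtain ⟨h₁, h₂⟩ := hprog' a ha
    rcases hcover (a * (w * b)) with h | h
    · exact .inl (sumProductPattern_subset_iff.2 ⟨h₁.1, hwb, h, h₁.2⟩)
    · exact .inr (sumProductPattern_subset_iff.2 ⟨h₂.1, hbD, by rwa [mul_assoc], h₂.2⟩)
  rcases hunion.of_union with h | h
  · exact .inl h
  · exact .inr ((h.image_mul_right (hS w)).mono (by rintro _ ⟨x, hx, rfl⟩; exact hx))

attribute [local instance] Ultrafilter.mul in
theorem exists_pattern_of_idempotent
    (hS : ∀ s : S, AddPiecewiseSyndetic (Set.range fun a : S => a * s)) {C D : Set S}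
    (hcover : ∀ x, x ∈ C ∨ x ∈ D) (k : ℕ) {p : Ultrafilter S} (hpp : p * p = p)
    (hp : ∀ E : Set S, FiniteIPStar E → E ∈ p) (hD : D ∈ p) {s : S}
    (hs : ∀ᶠ x in p, s * x ∈ C) :
    ∃ y : S, AddPiecewiseSyndetic {x : S | sumProductPattern k x y ⊆ C} ∨
      AddPiecewiseSyndetic {x : S | sumProductPattern k x y ⊆ D} := by
  have : Nonempty S := ⟨s⟩
  by_cases hC : AddPiecewiseSyndetic C
  · have hs' : ∀ᶠ x in p, ∀ᶠ x' in p, s * (x * x') ∈ C :=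
      (Ultrafilter.eventually_mul p p fun x => s * x ∈ C).1 (by rwa [hpp])
    have hprog := hp _ ((hC.finiteIPStar_progression k).preimage_mul_left s)
    obtain ⟨z, ⟨hz, hz'⟩, hzp⟩ := ((hs.and hs').and hprog).exists
    rcases exists_pattern_of_mul_mem hS hcover k hz hzp with h | ⟨E, hE, h⟩
    · exact ⟨_, .inl h⟩
    · obtain ⟨b, ⟨hbC, hbE⟩, hbD⟩ := ((hz'.and (hp E hE)).and hD).exists
      rcases h b hbE hbD (by rwa [mul_assoc]) with h | h
      · exact ⟨_, .inl h⟩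
      · exact ⟨_, .inr h⟩
  · obtain ⟨y, hy⟩ := Ultrafilter.nonempty_of_mem hD
    exact ⟨y, .inr (addPiecewiseSyndetic_pattern_of_not hS (fun x => (hcover x).symm) hC hy k)⟩

end Pattern

theorem mainTheorem3 {S : Type*} [AddCommSemigroup S] [Semigroup S]
    [LeftDistribClass S] [RightDistribClass S]
    (hS : ∀ s : S, AddPiecewiseSyndetic (Set.range fun a : S => a * s))
    (T : Set S) (hT : MulThick T)
    (M : Fin 2 → Set S) (hM : ∀ i, MulSyndetic (M i))
    (C : Fin 2 → Set S) (hcover : C 0 ∪ C 1 = Set.univ) (hdisj : Disjoint (C 0) (C 1))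
    (hC : ∀ i, T ∩ M i ⊆ C i) (k : ℕ) :
    ∃ (y : S) (i : Fin 2),
      AddPiecewiseSyndetic {x : S | sumProductPattern k x y ⊆ C i} := by
  obtain ⟨p, hpp, hpT, hp⟩ := hT.exists_idempotent
  have hs : ∀ i, ∃ s : S, ∀ᶠ x in p, s * x ∈ C i := by
    intro i
    obtain ⟨s, hs⟩ := (hM i).exists_eventually_mul_mem p
    exact ⟨s, ((hpT s).and hs).mono fun x hx => hC i hx⟩
  have hcov : ∀ x, x ∈ C 0 ∨ x ∈ C 1 := fun x => (Set.mem_union _ _ _).1 (by rw [hcover]; trivial)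
  rcases Ultrafilter.union_mem_iff.1 (hcover ▸ Filter.univ_mem : C 0 ∪ C 1 ∈ p) with h | h
  · obtain ⟨s, hs⟩ := hs 1
    obtain ⟨y, h | h⟩ := exists_pattern_of_idempotent hS (fun x => (hcov x).symm) k hpp hp h hs
    exacts [⟨y, 1, h⟩, ⟨y, 0, h⟩]
  · obtain ⟨s, hs⟩ := hs 0
    obtain ⟨y, h | h⟩ := exists_pattern_of_idempotent hS hcov k hpp hp h hs
    exacts [⟨y, 0, h⟩, ⟨y, 1, h⟩]
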